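/- Let $n$ be a non-negative integer, let $J_{2n}=\begin{pmatrix}0&I_n\\-I_n&0\end{pmatrix}$, let $\mathrm{Sp}(2n,\mathbb C)=\{g\in \mathrm{GL}(2n,\mathbb C) : g^TJ_{2n}g=J_{2n}\}$ be the complex symplectic group, and let $X$ be a complex $2n\times 2n$ skew-Hamiltonian matrix, that is, $X^TJ_{2n}=J_{2n}X$. Then $X$ is similar to $-X$ (that is, $gXg^{-1}=-X$ for some $g\in\mathrm{GL}(2n,\mathbb C)$) if and only if $X$ is similar to $-X$ via a symplectic involution, that is, there is $g\in\mathrm{Sp}(2n,\mathbb C)$ with $g^2=I_{2n}$ and $gXg^{-1}=-X$. -/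

import Mathlib

/-- The set `SH(2n, ℂ)` of skew-Hamiltonian matrices: those complex `2n × 2n` matrices `X` with
`Xᵀ J = J X`. Mathlib's `Matrix.J` is the block matrix `(0, -1; 1, 0)`; replacing `J` by `-J`
changes neither this set nor the symplectic group. -/
def skewHamiltonian (n : ℕ) : Set (Matrix (Fin n ⊕ Fin n) (Fin n ⊕ Fin n) ℂ) :=
  {X | X.transpose * Matrix.J (Fin n) ℂ = Matrix.J (Fin n) ℂ * X}

/-- Two square complex matrices are similar if `g A g⁻¹ = B` for some invertible `g`. -/
def MatrixSimilar {m : Type*} [Fintype m] [DecidableEq m] (A B : Matrix m m ℂ) : Prop :=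
  ∃ g : Matrix.GeneralLinearGroup m ℂ,
    (g : Matrix m m ℂ) * A * ((g⁻¹ : Matrix.GeneralLinearGroup m ℂ) : Matrix m m ℂ) = B

/-- `A` is similar to `B` via a symplectic involution: `g A g⁻¹ = B` for some `g` in the
symplectic group `Sp(2n, ℂ)` of order at most two. -/
def SimilarViaSymplecticInvolution {n : ℕ}
    (A B : Matrix (Fin n ⊕ Fin n) (Fin n ⊕ Fin n) ℂ) : Prop :=
  ∃ g : Matrix.symplecticGroup (Fin n) ℂ, g ^ 2 = 1 ∧
    (g : Matrix (Fin n ⊕ Fin n) (Fin n ⊕ Fin n) ℂ) * A *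
      ((g⁻¹ : Matrix.symplecticGroup (Fin n) ℂ) :
        Matrix (Fin n ⊕ Fin n) (Fin n ⊕ Fin n) ℂ) = B

/-! With $B(x,y)=x^TJy$, the matrix `X` is an endomorphism `f` self-adjoint for an alternating form.
A symplectic involution anticommuting with `f` amounts to an orthogonal splitting $V=P\oplus Q$
whose summands `f` swaps: its $\pm1$ eigenspaces (`IsSwapPair.exists_involution`). To find one,
first make the given `g` an isometry: if $g^*$ is its `B`-adjoint, $S=g^*g$ commutes with `f` and
has a square root `R` polynomial in `S`, so $k=gR^{-1}$ works (`exists_isometry_anticommute`). If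
`E` collects the generalized eigenspaces of one nonzero eigenvalue from each pair $\pm a$, then
$(1+k)E$ and $(1-k)E$ split the nonzero spectrum. On the generalized kernel, pairs of dual Jordan
chains are peeled off and sorted by parity (`IsSwapPair.exists_sup_eq_top`). -/

/-! ### Polynomial square roots -/

open Polynomial in
theorem Polynomial.dvd_pow_natDegree_of_isRoot {m q : ℂ[X]} (hm : m.Monic)
    (h : ∀ a, m.IsRoot a → q.IsRoot a) : m ∣ q ^ m.natDegree := by
  have hs := IsAlgClosed.splits m
  have e : m = (m.roots.map fun a => X - C a).prod :=
    hs.eq_prod_roots_of_monic hm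
  have hc : m.roots.card = m.natDegree := hs.natDegree_eq_card_roots.symm
  rw [← hc]
  conv_lhs => rw [e]
  have : (m.roots.map fun _ => q).prod = q ^ m.roots.card := by simp
  rw [← this]
  refine Multiset.prod_dvd_prod_of_dvd _ _ ?_
  intro a ha
  exact dvd_iff_isRoot.2 (h a (isRoot_of_mem_roots ha))

open Polynomial in
/-- An invertible endomorphism has a square root that is a polynomial in it. -/
theorem Module.End.exists_aeval_sq_eq {V : Type*} [AddCommGroup V] [Module ℂ V]
    [FiniteDimensional ℂ V] {S : Module.End ℂ V} (hS : IsUnit S) :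
    ∃ p : ℂ[X], aeval S p ^ 2 = S := by
  set m := minpoly ℂ S with hm
  have hmon : m.Monic := minpoly.monic (Algebra.IsIntegral.isIntegral S)
  have h0 : ¬ m.IsRoot 0 := by
    rw [hm, ← Module.End.hasEigenvalue_iff_isRoot]
    intro h
    obtain ⟨v, hv⟩ := h.exists_hasEigenvector
    apply hv.2
    have h1 := hv.apply_eq_smul
    rw [zero_smul] at h1
    exact ((Module.End.isUnit_iff S).1 hS).1 (by simpa using h1)
  choose r hr using fun z : ℂ => IsAlgClosed.exists_pow_nat_eq z (n := 2) (by norm_num)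
  -- Correct at every root of `m`, hence a square root of `X` modulo nilpotents in `Q`.
  set p := Lagrange.interpolate m.roots.toFinset id r with hp
  have hp' : ∀ a, m.IsRoot a → (p ^ 2 - X).IsRoot a := by
    intro a ha
    have : p.eval a = r a := by
      have := Lagrange.eval_interpolate_at_node (s := m.roots.toFinset) (v := id) (i := a) r
        Function.injective_id.injOn (by simpa [hmon.ne_zero] using ha)
      exact this
    simp [this, hr]
  let Q := ℂ[X] ⧸ Ideal.span {m}
  let π : ℂ[X] →ₐ[ℂ] Q := Ideal.Quotient.mkₐ ℂ (Ideal.span {m})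
  have hπ : ∀ a, π a = 0 ↔ m ∣ a := fun a => by
    change Ideal.Quotient.mk _ a = 0 ↔ _
    rw [Ideal.Quotient.eq_zero_iff_mem, Ideal.mem_span_singleton]
  have hnil : IsNilpotent (π p ^ 2 - π X) :=
    ⟨m.natDegree, by
      rw [← map_pow, ← map_sub, ← map_pow, hπ]
      exact dvd_pow_natDegree_of_isRoot hmon hp'⟩
  have hX : IsUnit (π X) := by
    have hc : IsCoprime X m := by
      rw [irreducible_X.coprime_iff_not_dvd, X_dvd_iff, coeff_zero_eq_eval_zero]
      exact h0
    obtain ⟨a, b, hab⟩ := hc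
    refine IsUnit.of_mul_eq_one (π a) ?_
    have := congrArg π hab
    rw [map_add, map_mul, map_mul, (hπ m).2 dvd_rfl, mul_zero, add_zero, map_one] at this
    rw [mul_comm, this]
  have hpu : IsUnit (π p) := by
    have : IsUnit (π p ^ 2) := by
      have := hnil.isUnit_add_left_of_commute hX (Commute.all _ _)
      simpa using this
    exact (isUnit_pow_iff two_ne_zero).1 this
  -- Newton–Hensel lifting of `p` to an exact root of $T^2-X$; the derivative $2p$ is a unit.
  obtain ⟨y, ⟨-, hy⟩, -⟩ := existsUnique_nilpotent_sub_and_aeval_eq_zero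
    (R := Q) (S := Q) (P := X ^ 2 - C (π X)) (x := π p)
    (by simpa using hnil)
    (by
      have h2 : IsUnit (2 : Q) := by
        have := (IsUnit.mk0 (2 : ℂ) two_ne_zero).map (algebraMap ℂ Q)
        rwa [map_ofNat] at this
      have : aeval (π p) (derivative (X ^ 2 - C (π X))) = 2 * π p := by
        simp [one_add_one_eq_two]
      exact this ▸ h2.mul hpu)
  obtain ⟨q, rfl⟩ := Ideal.Quotient.mkₐ_surjective ℂ (Ideal.span {m}) y
  refine ⟨q, ?_⟩
  have hd : m ∣ q ^ 2 - X := by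
    rw [← hπ, map_sub, map_pow]
    simp only [map_sub, map_pow, aeval_X, aeval_C] at hy
    exact hy
  have := (minpoly.dvd_iff).1 hd
  simpa [sub_eq_zero] using this

/-! ### Self-adjoint endomorphisms of an alternating form -/

namespace LinearMap.BilinForm

variable {V : Type*} [AddCommGroup V] [Module ℂ V] {B : LinearMap.BilinForm ℂ V}
  {f : Module.End ℂ V}

theorem apply_pow_left (hf : ∀ x y, B (f x) y = B x (f y)) (n : ℕ) (x y : V) :
    B ((f ^ n) x) y = B x ((f ^ n) y) := by
  induction n generalizing x with
  | zero => rfl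
  | succ n ih => rw [pow_succ, Module.End.mul_apply, ih, hf, ← Module.End.mul_apply, ← pow_succ', pow_succ]

theorem apply_aeval_left (hf : ∀ x y, B (f x) y = B x (f y)) (p : Polynomial ℂ) (x y : V) :
    B (Polynomial.aeval f p x) y = B x (Polynomial.aeval f p y) := by
  induction p using Polynomial.induction_on' with
  | add a b ha hb => simp [ha, hb]
  | monomial n a => simp [Polynomial.aeval_monomial, Algebra.algebraMap_eq_smul_one,
      apply_pow_left hf]

theorem IsAlt.eq_neg (hA : B.IsAlt) (x y : V) : B x y = -B y x :=
  (hA.neg_eq y x).symm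

/-- An invertible map anticommuting with a self-adjoint endomorphism can be replaced
by an isometry of the alternating form. -/
theorem exists_isometry_anticommute [FiniteDimensional ℂ V] (hB : B.Nondegenerate) (hA : B.IsAlt)
    {g : Module.End ℂ V} (hf : ∀ x y, B (f x) y = B x (f y)) (hg : IsUnit g)
    (hgf : ∀ x, g (f x) = -f (g x)) :
    ∃ k : Module.End ℂ V, (∀ x y, B (k x) (k y) = B x y) ∧ ∀ x, k (f x) = -f (k x) := by
  set S : Module.End ℂ V := B.leftAdjointOfNondegenerate hB g * g with hSdef
  have hS : ∀ x y, B (S x) y = B (g x) (g y) := fun x y =>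
    B.isAdjointPairLeftAdjointOfNondegenerate hB g (g x) y
  have ext : ∀ {x y : V}, (∀ z, B x z = B y z) → x = y := fun {x y} h => by
    rw [← sub_eq_zero]
    exact hB.1 _ fun z => by simp [h z]
  have hSs : ∀ x y, B (S x) y = B x (S y) := fun x y => by
    rw [hS, hA.eq_neg, ← hS, ← hA.eq_neg]
  -- `g` occurs twice in `S`, so the two signs cancel.
  have hSf : Commute S f := by
    ext x
    refine ext fun z => ?_
    change B (S (f x)) z = B (f (S x)) z
    rw [hS, hf, hS, hgf, hgf, map_neg, map_neg, LinearMap.neg_apply, hf]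
  have hSu : IsUnit S := by
    rw [LinearMap.isUnit_iff_ker_eq_bot, LinearMap.ker_eq_bot']
    intro x hx
    have hgb := (Module.End.isUnit_iff g).1 hg
    apply hgb.1
    rw [map_zero]
    refine hB.1 _ fun z => ?_
    obtain ⟨z, rfl⟩ := hgb.2 z
    rw [← hS, hx]; simp
  obtain ⟨p, hp⟩ := Module.End.exists_aeval_sq_eq hSu
  set R := Polynomial.aeval S p with hR
  have hRf : Commute R f := by
    rw [hR]
    exact (Algebra.commute_of_mem_adjoin_singleton_of_commute
      (Polynomial.aeval_mem_adjoin_singleton ℂ S) hSf.symm).symm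
  have hRs : ∀ x y, B (R x) y = B x (R y) := apply_aeval_left hSs p
  have hRu : IsUnit R := (isUnit_pow_iff two_ne_zero).1 (hp ▸ hSu)
  obtain ⟨u, hu⟩ := hRu
  have hRR : ∀ x, R ((↑u⁻¹ : Module.End ℂ V) x) = x := fun x => by
    rw [← hu, ← Module.End.mul_apply, u.mul_inv]; rfl
  have huf : ∀ x, (↑u⁻¹ : Module.End ℂ V) (f x) = f ((↑u⁻¹ : Module.End ℂ V) x) := fun x => by
    have : Commute (↑u⁻¹ : Module.End ℂ V) f := Commute.units_inv_left (hu ▸ hRf)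
    exact LinearMap.congr_fun this.eq x
  refine ⟨g * ↑u⁻¹, fun x y => ?_, fun x => ?_⟩
  · rw [Module.End.mul_apply, Module.End.mul_apply, ← hS, ← hp, pow_two, Module.End.mul_apply,
      hRs, hRR, hRR]
  · rw [Module.End.mul_apply, Module.End.mul_apply, huf, hgf]

/-! ### Swap pairs and dual Jordan chains -/

/-- A pair of mutually orthogonal subspaces that are swapped by `f`. -/
structure IsSwapPair (B : LinearMap.BilinForm ℂ V) (f : Module.End ℂ V)
    (P Q : Submodule ℂ V) : Prop where
  orth : ∀ x ∈ P, ∀ y ∈ Q, B x y = 0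
  map_left : ∀ x ∈ P, f x ∈ Q
  map_right : ∀ x ∈ Q, f x ∈ P

theorem apply_pow_pow (hf : ∀ x y, B (f x) y = B x (f y)) (i j : ℕ) (x y : V) :
    B ((f ^ i) x) ((f ^ j) y) = B ((f ^ (i + j)) x) y := by
  rw [← apply_pow_left hf, ← Module.End.mul_apply, ← pow_add, add_comm]

theorem apply_pow_self (hA : B.IsAlt) (hf : ∀ x y, B (f x) y = B x (f y)) (n : ℕ) (x : V) :
    B ((f ^ n) x) x = 0 := by
  have h := apply_pow_left hf n x x
  rw [hA.eq_neg x] at h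
  exact self_eq_neg.1 h

/-- The span of the vectors `f ^ i v` with `i + s` even and `f ^ i w` with `i + K + s` even. -/
def chainSpan (f : Module.End ℂ V) (v w : V) (K s : ℕ) : Submodule ℂ V :=
  Submodule.span ℂ {x | ∃ i, (Even (i + s) ∧ x = (f ^ i) v) ∨ (Even (i + K + s) ∧ x = (f ^ i) w)}

theorem chainSpan_le {U : Submodule ℂ V} {v w : V} (hv : ∀ i, (f ^ i) v ∈ U)
    (hw : ∀ i, (f ^ i) w ∈ U) (K s : ℕ) : chainSpan f v w K s ≤ U := by
  refine Submodule.span_le.2 ?_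
  rintro x ⟨i, ⟨-, rfl⟩ | ⟨-, rfl⟩⟩
  exacts [hv i, hw i]

theorem pow_left_mem_chainSpan (f : Module.End ℂ V) (v w : V) (K i : ℕ) :
    (f ^ i) v ∈ chainSpan f v w K 0 ⊔ chainSpan f v w K 1 := by
  rcases Nat.even_or_odd i with h | h
  · exact Submodule.mem_sup_left (Submodule.subset_span ⟨i, .inl ⟨h, rfl⟩⟩)
  · exact Submodule.mem_sup_right (Submodule.subset_span ⟨i, .inl ⟨h.add_one, rfl⟩⟩)

theorem pow_right_mem_chainSpan (f : Module.End ℂ V) (v w : V) (K i : ℕ) :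
    (f ^ i) w ∈ chainSpan f v w K 0 ⊔ chainSpan f v w K 1 := by
  rcases Nat.even_or_odd (i + K) with h | h
  · exact Submodule.mem_sup_left (Submodule.subset_span ⟨i, .inr ⟨h, rfl⟩⟩)
  · exact Submodule.mem_sup_right (Submodule.subset_span ⟨i, .inr ⟨h.add_one, rfl⟩⟩)

theorem apply_mem_chainSpan {v w x : V} {K s t : ℕ} (h : Odd (s + t))
    (hx : x ∈ chainSpan f v w K s) : f x ∈ chainSpan f v w K t := by
  change x ∈ (chainSpan f v w K t).comap f
  refine Submodule.span_le.2 ?_ hx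
  rintro x ⟨i, ⟨hi, rfl⟩ | ⟨hi, rfl⟩⟩ <;>
    refine Submodule.subset_span ⟨i + 1, ?_⟩ <;> rw [pow_succ', Module.End.mul_apply]
  · exact .inl ⟨by grind, rfl⟩
  · exact .inr ⟨by grind, rfl⟩

/-- Each chain is isotropic, and $f^iv$ pairs with $f^jw$ only when $i+j=K$, which parity excludes
across the two spans. -/
theorem isSwapPair_chainSpan (hA : B.IsAlt) (hf : ∀ x y, B (f x) y = B x (f y)) {v w : V} {K : ℕ}
    (h : ∀ i, B ((f ^ i) v) w = if i = K then 1 else 0) :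
    IsSwapPair B f (chainSpan f v w K 0) (chainSpan f v w K 1) where
  orth x hx y hy := by
    refine Submodule.span_induction₂ (p := fun x y _ _ => B x y = 0) ?_ ?_ ?_ ?_ ?_ ?_ ?_ hx hy
    · rintro _ _ ⟨i, ⟨hi, rfl⟩ | ⟨hi, rfl⟩⟩ ⟨j, ⟨hj, rfl⟩ | ⟨hj, rfl⟩⟩
      · rw [apply_pow_pow hf, apply_pow_self hA hf]
      · rw [apply_pow_pow hf, h, if_neg (by grind)]
      · rw [hA.eq_neg, apply_pow_pow hf, h, if_neg (by grind), neg_zero]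
      · rw [apply_pow_pow hf, apply_pow_self hA hf]
    all_goals intros; simp_all
  map_left _ := apply_mem_chainSpan (by decide)
  map_right _ := apply_mem_chainSpan (by decide)

/-- Gram–Schmidt along the chain: subtracting a multiple of $f^{m+1}w$ kills the pairing with
$f^{K-(m+1)}v$ and, since $f^{K+1}v=0$, leaves those with higher powers intact. -/
theorem exists_dual_chain (hf : ∀ x y, B (f x) y = B x (f y)) {U : Submodule ℂ V}
    (hU : ∀ x ∈ U, f x ∈ U) {K : ℕ} {v w : V} (hv : (f ^ (K + 1)) v = 0) (hw : w ∈ U)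
    (hvw : B ((f ^ K) v) w = 1) :
    ∃ w ∈ U, ∀ i, B ((f ^ i) v) w = if i = K then 1 else 0 := by
  have hUn : ∀ n, ∀ x ∈ U, (f ^ n) x ∈ U := fun n => by
    induction n with
    | zero => exact fun _ h => h
    | succ n ih => intro x hx; rw [pow_succ, Module.End.mul_apply]; exact ih _ (hU x hx)
  have hv' : ∀ i, K < i → (f ^ i) v = 0 := fun i hi => by
    obtain ⟨j, rfl⟩ := Nat.exists_eq_add_of_lt hi
    rw [show K + j + 1 = j + (K + 1) by ring, pow_add, Module.End.mul_apply, hv, map_zero]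
  have key : ∀ m, ∃ w ∈ U, B ((f ^ K) v) w = 1 ∧ ∀ i < K, K ≤ i + m → B ((f ^ i) v) w = 0 := by
    intro m
    induction m with
    | zero => exact ⟨w, hw, hvw, fun i h1 h2 => by omega⟩
    | succ m ih =>
      obtain ⟨w, hw, h1, h2⟩ := ih
      rcases lt_or_ge m K with hm | hm
      · refine ⟨w - B ((f ^ (K - (m + 1))) v) w • (f ^ (m + 1)) w,
          U.sub_mem hw (U.smul_mem _ (hUn _ _ hw)), ?_, fun i hi hi' => ?_⟩
        · rw [map_sub, map_smul, apply_pow_pow hf, hv' (K + (m + 1)) (by omega), h1]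
          simp
        · rw [map_sub, map_smul, apply_pow_pow hf]
          rcases eq_or_lt_of_le hi' with e | e
          · rw [← e, h1, show K - (m + 1) = i by omega]; simp
          · rw [h2 i hi (by omega), hv' (i + (m + 1)) (by omega)]; simp
      · exact ⟨w, hw, h1, fun i hi _ => h2 i hi (by omega)⟩
  obtain ⟨w, hw, h1, h2⟩ := key K
  refine ⟨w, hw, fun i => ?_⟩
  split_ifs with h
  · rw [h, h1]
  · rcases lt_or_gt_of_ne h with h | h
    · exact h2 i h (by omega)
    · rw [hv' i h]; simp

/-- Orthogonal projection onto the span of a dual pair of chains. -/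
theorem exists_mem_chainSpan_sub_orthogonal (hA : B.IsAlt)
    (hf : ∀ x y, B (f x) y = B x (f y)) {v w : V} {K : ℕ}
    (h : ∀ i, B ((f ^ i) v) w = if i = K then 1 else 0)
    (hv : (f ^ (K + 1)) v = 0) (hw : (f ^ (K + 1)) w = 0) (u : V) :
    ∃ y ∈ chainSpan f v w K 0 ⊔ chainSpan f v w K 1,
      ∀ m, B ((f ^ m) v) (u - y) = 0 ∧ B ((f ^ m) w) (u - y) = 0 := by
  have hz : ∀ x, (f ^ (K + 1)) x = 0 → ∀ i, K < i → (f ^ i) x = 0 := fun x hx i hi => by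
    obtain ⟨j, rfl⟩ := Nat.exists_eq_add_of_lt hi
    rw [show K + j + 1 = j + (K + 1) by ring, pow_add, Module.End.mul_apply, hx, map_zero]
  -- Expansion in the dual basis: $f^iw$ is dual to $f^{K-i}v$, and the minus sign comes from
  -- $B(f^Kw,v)=-1$.
  refine ⟨∑ i ∈ Finset.range (K + 1), (B ((f ^ (K - i)) v) u • (f ^ i) w
      - B ((f ^ (K - i)) w) u • (f ^ i) v), Submodule.sum_mem _ fun i _ => Submodule.sub_mem _
      (Submodule.smul_mem _ _ (pow_right_mem_chainSpan f v w K i))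
      (Submodule.smul_mem _ _ (pow_left_mem_chainSpan f v w K i)), fun m => ?_⟩
  rcases lt_or_ge K m with hm | hm
  · rw [hz v hv m hm, hz w hw m hm]; simp
  have hwv : ∀ i, B ((f ^ i) w) v = if i = K then -1 else 0 := fun i => by
    rw [hA.eq_neg, ← apply_pow_left hf, h]; split_ifs <;> simp
  have e : ∀ i ∈ Finset.range (K + 1), (m + i = K ↔ K - m = i) := fun i hi => by
    rw [Finset.mem_range] at hi; omega
  constructor
  · rw [map_sub, map_sum, sub_eq_zero]
    simp only [map_sub, map_smul, apply_pow_pow hf, h, apply_pow_self hA hf, smul_eq_mul, mul_zero,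
      sub_zero, mul_ite, mul_one]
    rw [Finset.sum_congr rfl fun i hi => if_congr (e i hi) rfl rfl, Finset.sum_ite_eq,
      if_pos (by grind), Nat.sub_sub_self hm]
  · rw [map_sub, map_sum, sub_eq_zero]
    simp only [map_sub, map_smul, apply_pow_pow hf, hwv, apply_pow_self hA hf, smul_eq_mul, mul_zero,
      zero_sub, mul_ite, mul_neg, mul_one, neg_ite, neg_neg, neg_zero]
    rw [Finset.sum_congr rfl fun i hi => if_congr (e i hi) rfl rfl, Finset.sum_ite_eq,
      if_pos (by grind), Nat.sub_sub_self hm]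

/-- If `f` is nilpotent on the orthogonal complement of a nondegenerate swap pair, the pair
extends to one that spans the whole space. -/
theorem IsSwapPair.exists_sup_eq_top [FiniteDimensional ℂ V] (hB : B.Nondegenerate) (hA : B.IsAlt)
    (hf : ∀ x y, B (f x) y = B x (f y)) {P Q : Submodule ℂ V} (h : IsSwapPair B f P Q)
    (hPQ : P ⊔ Q ⊔ B.orthogonal (P ⊔ Q) = ⊤) {n : ℕ}
    (hn : ∀ x ∈ B.orthogonal (P ⊔ Q), (f ^ n) x = 0) :
    ∃ P' Q' : Submodule ℂ V, IsSwapPair B f P' Q' ∧ P' ⊔ Q' = ⊤ := by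
  induction hd : Module.finrank ℂ (B.orthogonal (P ⊔ Q)) using Nat.strong_induction_on
    generalizing P Q with
  | _ d ih =>
  set U := B.orthogonal (P ⊔ Q) with hUdef
  by_cases hU0 : U = ⊥
  · exact ⟨P, Q, h, by rwa [hU0, sup_bot_eq] at hPQ⟩
  have hsup : ∀ x ∈ P ⊔ Q, f x ∈ P ⊔ Q := fun x hx => by
    obtain ⟨a, ha, b, hb, rfl⟩ := Submodule.mem_sup.1 hx
    rw [map_add, add_comm]
    exact Submodule.add_mem_sup (h.map_right b hb) (h.map_left a ha)
  have hfU : ∀ x ∈ U, f x ∈ U := fun x hx y hy => by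
    change B y (f x) = 0
    rw [← hf]
    exact hx _ (hsup y hy)
  have hUn : ∀ i, ∀ x ∈ U, (f ^ i) x ∈ U := fun i => by
    induction i with
    | zero => exact fun _ h => h
    | succ i ih => intro x hx; rw [pow_succ, Module.End.mul_apply]; exact ih _ (hfU x hx)
  classical
  have hex : ∃ k, ∀ x ∈ U, (f ^ k) x = 0 := ⟨n, hn⟩
  -- `K + 1` is the nilpotency index of `f` on `U`, so both chains die at the same power.
  obtain ⟨K, hK⟩ : ∃ K, Nat.find hex = K + 1 := Nat.exists_eq_succ_of_ne_zero fun h0 => by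
    have := Nat.find_spec hex
    rw [h0] at this
    exact hU0 ((Submodule.eq_bot_iff _).2 this)
  have hKU : ∀ x ∈ U, (f ^ (K + 1)) x = 0 := hK ▸ Nat.find_spec hex
  obtain ⟨v, hv, hv0⟩ : ∃ v ∈ U, (f ^ K) v ≠ 0 := by
    have := Nat.find_min hex (m := K) (by omega)
    push Not at this
    exact this
  obtain ⟨w₀, hw₀, hvw₀⟩ : ∃ w ∈ U, B ((f ^ K) v) w = 1 := by
    obtain ⟨z, hz⟩ : ∃ z, B ((f ^ K) v) z ≠ 0 := by
      by_contra! hc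
      exact hv0 (hB.1 _ hc)
    obtain ⟨a, ha, u, hu, rfl⟩ := Submodule.mem_sup.1 (hPQ ▸ Submodule.mem_top : z ∈ P ⊔ Q ⊔ U)
    rw [map_add, hA.eq_neg _ a, show B a ((f ^ K) v) = 0 from hUn K v hv a ha, neg_zero,
      zero_add] at hz
    exact ⟨(B ((f ^ K) v) u)⁻¹ • u, U.smul_mem _ hu, by simp [hz]⟩
  obtain ⟨w, hw, hvw⟩ := exists_dual_chain hf hfU (hKU v hv) hw₀ hvw₀
  have hW := isSwapPair_chainSpan hA hf hvw
  have hWU := fun s => chainSpan_le (fun i => hUn i v hv) (fun i => hUn i w hw) K s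
  set W₀ := chainSpan f v w K 0 with hW₀
  set W₁ := chainSpan f v w K 1 with hW₁
  have hortho : ∀ x ∈ P ⊔ Q, ∀ y ∈ U, B x y = 0 := fun x hx y hy => hy x hx
  have hswap : IsSwapPair B f (P ⊔ W₀) (Q ⊔ W₁) := by
    refine ⟨fun x hx y hy => ?_, fun x hx => ?_, fun x hx => ?_⟩
    · obtain ⟨a, ha, b, hb, rfl⟩ := Submodule.mem_sup.1 hx
      obtain ⟨c, hc, d, hd, rfl⟩ := Submodule.mem_sup.1 hy
      have h1 := h.orth a ha c hc
      have h2 := hW.orth b hb d hd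
      have h3 := hortho a (Submodule.mem_sup_left ha) d (hWU 1 hd)
      have h4 : B b c = 0 := by
        rw [hA.eq_neg, hortho c (Submodule.mem_sup_right hc) b (hWU 0 hb), neg_zero]
      simp [h1, h2, h3, h4]
    · obtain ⟨a, ha, b, hb, rfl⟩ := Submodule.mem_sup.1 hx
      rw [map_add]
      exact Submodule.add_mem_sup (h.map_left a ha) (hW.map_left b hb)
    · obtain ⟨a, ha, b, hb, rfl⟩ := Submodule.mem_sup.1 hx
      rw [map_add]
      exact Submodule.add_mem_sup (h.map_right a ha) (hW.map_right b hb)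
  have hle : B.orthogonal (P ⊔ W₀ ⊔ (Q ⊔ W₁)) ≤ U :=
    orthogonal_le (sup_le_sup le_sup_left le_sup_left)
  have hlt : B.orthogonal (P ⊔ W₀ ⊔ (Q ⊔ W₁)) < U := by
    refine lt_of_le_of_ne hle fun e => ?_
    have h1 : w ∈ B.orthogonal (P ⊔ W₀ ⊔ (Q ⊔ W₁)) := e ▸ hw
    have h2 : (f ^ K) v ∈ P ⊔ W₀ ⊔ (Q ⊔ W₁) :=
      (sup_le_sup le_sup_right le_sup_right : W₀ ⊔ W₁ ≤ _) (pow_left_mem_chainSpan f v w K K)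
    have h3 : B ((f ^ K) v) w = 0 := h1 _ h2
    rw [hvw, if_pos rfl] at h3
    exact one_ne_zero h3
  refine ih _ (hd ▸ Submodule.finrank_lt_finrank_of_lt hlt) hswap ?_
    (fun x hx => hn x (hle hx)) rfl
  rw [eq_top_iff, ← hPQ, show P ⊔ W₀ ⊔ (Q ⊔ W₁) = P ⊔ Q ⊔ (W₀ ⊔ W₁) from sup_sup_sup_comm ..]
  refine sup_le (le_sup_left.trans le_sup_left) fun u hu => ?_
  obtain ⟨y, hy, hy'⟩ := exists_mem_chainSpan_sub_orthogonal hA hf hvw (hKU v hv) (hKU w hw) u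
  rw [← add_sub_cancel y u]
  refine Submodule.add_mem_sup (Submodule.mem_sup_right hy) fun x hx => ?_
  have hyU : u - y ∈ U := U.sub_mem hu (sup_le (hWU 0) (hWU 1) hy)
  obtain ⟨a, ha, b, hb, rfl⟩ := Submodule.mem_sup.1 hx
  have hle' := fun s => chainSpan_le (U := LinearMap.ker (B.flip (u - y)))
    (fun m => (hy' m).1) (fun m => (hy' m).2) K s
  have hb0 : B b (u - y) = 0 := (sup_le (hle' 0) (hle' 1) : W₀ ⊔ W₁ ≤ _) hb
  change B (a + b) (u - y) = 0
  rw [map_add, LinearMap.add_apply, hortho a ha _ hyU, zero_add]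
  exact hb0

/-! ### Generalized eigenspaces and the nonzero spectrum -/

-- By Bézout, $(f-a)^m$ is invertible on vectors killed by $(f-b)^n$; self-adjointness moves it onto
-- `x`, which it kills.
open Polynomial in
theorem apply_eq_zero_of_mem_maxGenEigenspace (hf : ∀ x y, B (f x) y = B x (f y)) {a b : ℂ}
    (hab : a ≠ b) {x y : V} (hx : x ∈ f.maxGenEigenspace a) (hy : y ∈ f.maxGenEigenspace b) :
    B x y = 0 := by
  obtain ⟨m, hm⟩ := (f.mem_maxGenEigenspace a x).1 hx
  obtain ⟨n, hn⟩ := (f.mem_maxGenEigenspace b y).1 hy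
  have e : ∀ (c : ℂ) (k : ℕ), aeval f ((X - C c) ^ k) = (f - c • (1 : Module.End ℂ V)) ^ k :=
    fun c k => by simp [Algebra.algebraMap_eq_smul_one]
  obtain ⟨p, q, hpq⟩ := (isCoprime_X_sub_C_of_isUnit_sub
    (sub_ne_zero.2 hab).isUnit).pow (m := m) (n := n)
  rw [← e] at hm hn
  have h1 : y = aeval f ((X - C a) ^ m) (aeval f p y) := by
    have := congrArg (fun r => aeval f r y) hpq
    simp only [map_add, map_mul, map_one, LinearMap.add_apply, Module.End.mul_apply, hn, map_zero,
      add_zero, Module.End.one_apply] at this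
    rw [← Module.End.mul_apply, ← map_mul, mul_comm, map_mul, Module.End.mul_apply, this]
  rw [h1, ← apply_aeval_left hf, hm, map_zero, LinearMap.zero_apply]

theorem IsAlt.le_orthogonal_comm (hA : B.IsAlt) {P Q : Submodule ℂ V} :
    P ≤ B.orthogonal Q ↔ Q ≤ B.orthogonal P :=
  ⟨fun h x hx _ hy => hA.isRefl _ _ (h hy x hx), fun h x hx _ hy => hA.isRefl _ _ (h hy x hx)⟩

theorem pow_sub_smul_apply_of_anticommute {k : Module.End ℂ V} (hk : ∀ x, k (f x) = -f (k x))
    (a : ℂ) (n : ℕ) (x : V) :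
    ((f - (-a) • (1 : Module.End ℂ V)) ^ n) (k x) =
      (-1 : ℂ) ^ n • k (((f - a • (1 : Module.End ℂ V)) ^ n) x) := by
  induction n generalizing x with
  | zero => simp
  | succ n ih =>
    have h : (f - (-a) • (1 : Module.End ℂ V)) (k x) = k (-((f - a • (1 : Module.End ℂ V)) x)) := by
      simp [hk, add_comm]
    rw [pow_succ, Module.End.mul_apply, h, ih, pow_succ (f - a • 1), Module.End.mul_apply,
      pow_succ (-1), mul_smul, map_neg, map_neg, neg_one_smul]

theorem apply_mem_maxGenEigenspace_neg_iff {k : Module.End ℂ V}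
    (hk : ∀ x, k (f x) = -f (k x)) (hinj : Function.Injective k) {a : ℂ} {x : V} :
    k x ∈ f.maxGenEigenspace (-a) ↔ x ∈ f.maxGenEigenspace a := by
  rw [Module.End.mem_maxGenEigenspace, Module.End.mem_maxGenEigenspace]
  refine exists_congr fun n => ?_
  rw [pow_sub_smul_apply_of_anticommute hk, smul_eq_zero_iff_right (by simp),
    map_eq_zero_iff k hinj]

/-- The sum of the generalized eigenspaces whose eigenvalues lie in `s`. -/
def eigenSum (f : Module.End ℂ V) (s : Set ℂ) : Submodule ℂ V :=
  ⨆ a ∈ s, f.maxGenEigenspace a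

theorem eigenSum_le_orthogonal (hA : B.IsAlt) (hf : ∀ x y, B (f x) y = B x (f y)) {s t : Set ℂ}
    (hst : Disjoint s t) : eigenSum f s ≤ B.orthogonal (eigenSum f t) := by
  refine iSup₂_le fun a ha => hA.le_orthogonal_comm.1 <| iSup₂_le fun b hb => ?_
  intro y hy x hx
  exact apply_eq_zero_of_mem_maxGenEigenspace hf (hst.ne_of_mem ha hb) hx hy

theorem apply_mem_eigenSum {s : Set ℂ} {x : V} (hx : x ∈ eigenSum f s) : f x ∈ eigenSum f s := by
  have : eigenSum f s ≤ (eigenSum f s).comap f := iSup₂_le fun a ha y hy =>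
    Submodule.mem_iSup_of_mem a (Submodule.mem_iSup_of_mem ha
      (Module.End.mapsTo_maxGenEigenspace_of_comm (Commute.refl f) a hy))
  exact this hx

theorem map_eigenSum {k : Module.End ℂ V} (hk : ∀ x, k (f x) = -f (k x))
    (hbij : Function.Bijective k) (s : Set ℂ) : (eigenSum f s).map k = eigenSum f (-s) := by
  apply le_antisymm
  · rw [Submodule.map_le_iff_le_comap]
    refine iSup₂_le fun a ha x hx => ?_
    exact Submodule.mem_iSup_of_mem (-a) (Submodule.mem_iSup_of_mem (by simpa)
      ((apply_mem_maxGenEigenspace_neg_iff hk hbij.1).2 hx))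
  · refine iSup₂_le fun a ha x hx => ?_
    obtain ⟨y, rfl⟩ := hbij.2 x
    rw [← neg_neg a] at hx
    exact ⟨y, Submodule.mem_iSup_of_mem (-a) (Submodule.mem_iSup_of_mem ha
      ((apply_mem_maxGenEigenspace_neg_iff hk hbij.1).1 hx)), rfl⟩

/-- A set of representatives of the nonzero complex numbers up to sign. -/
def upperHalf : Set ℂ := {z | 0 < z.re ∨ z.re = 0 ∧ 0 < z.im}

/-- `E` is orthogonal to $kE$, so $B(x+kx,y-ky)=B(x,y)-B(kx,ky)=0$; anticommutation makes `f` swap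
the two images. -/
theorem exists_isSwapPair_sup_eq_top [FiniteDimensional ℂ V] (hB : B.Nondegenerate)
    (hA : B.IsAlt) (hf : ∀ x y, B (f x) y = B x (f y)) {k : Module.End ℂ V}
    (hiso : ∀ x y, B (k x) (k y) = B x y) (hk : ∀ x, k (f x) = -f (k x)) :
    ∃ P Q : Submodule ℂ V, IsSwapPair B f P Q ∧ P ⊔ Q = ⊤ := by
  have hinj : Function.Injective k := by
    rw [← LinearMap.ker_eq_bot, LinearMap.ker_eq_bot']
    intro x hx
    exact hB.1 _ fun y => by rw [← hiso, hx]; simp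
  have hbij : Function.Bijective k := ⟨hinj, LinearMap.injective_iff_surjective.1 hinj⟩
  set E := eigenSum f upperHalf with hE
  have hEk : E.map k = eigenSum f (-upperHalf) := map_eigenSum hk hbij _
  have hd : Disjoint upperHalf (-upperHalf) := Set.disjoint_left.2 fun z h1 h2 => by
    simp only [upperHalf, Set.mem_neg, Set.mem_ofPred_eq, Complex.neg_re, Complex.neg_im] at h1 h2
    grind
  have horth : ∀ x ∈ E, ∀ y ∈ E, B x (k y) = 0 := fun x hx y hy =>
    (hA.le_orthogonal_comm.1 (eigenSum_le_orthogonal hA hf hd))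
      (hEk ▸ Submodule.mem_map_of_mem hy) x hx
  have h0 : IsSwapPair B f (E.map (1 + k)) (E.map (1 - k)) := by
    refine ⟨?_, ?_, ?_⟩
    · rintro _ ⟨x, hx, rfl⟩ _ ⟨y, hy, rfl⟩
      have h1 := horth x hx y hy
      have h2 : B (k x) y = 0 := by rw [hA.eq_neg, horth y hy x hx, neg_zero]
      simp [h1, h2, hiso]
    · rintro _ ⟨x, hx, rfl⟩
      exact ⟨f x, apply_mem_eigenSum hx, by simp [hk]⟩
    · rintro _ ⟨x, hx, rfl⟩
      exact ⟨f x, apply_mem_eigenSum hx, by simp [hk, sub_eq_add_neg]⟩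
  set P := E.map (1 + k)
  set Q := E.map (1 - k)
  have hPQ : P ⊔ Q = eigenSum f (upperHalf ∪ -upperHalf) := by
    have hu : eigenSum f (upperHalf ∪ -upperHalf) = E ⊔ E.map k := by
      rw [hEk]; exact iSup_union
    rw [hu]
    apply le_antisymm
    · refine sup_le ?_ ?_ <;> rintro _ ⟨x, hx, rfl⟩
      · exact Submodule.add_mem_sup hx (Submodule.mem_map_of_mem hx)
      · rw [LinearMap.sub_apply, sub_eq_add_neg]
        exact Submodule.add_mem_sup hx (Submodule.neg_mem _ (Submodule.mem_map_of_mem hx))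
    · have key : ∀ x ∈ E, x ∈ P ⊔ Q ∧ k x ∈ P ⊔ Q := fun x hx => by
        have h1 : (1 + k) x ∈ P ⊔ Q := Submodule.mem_sup_left (Submodule.mem_map_of_mem hx)
        have h2 : (1 - k) x ∈ P ⊔ Q := Submodule.mem_sup_right (Submodule.mem_map_of_mem hx)
        constructor
        · convert (P ⊔ Q).smul_mem (2⁻¹ : ℂ) ((P ⊔ Q).add_mem h1 h2) using 1
          simp only [LinearMap.add_apply, LinearMap.sub_apply, Module.End.one_apply]
          module
        · convert (P ⊔ Q).smul_mem (2⁻¹ : ℂ) ((P ⊔ Q).sub_mem h1 h2) using 1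
          simp only [LinearMap.add_apply, LinearMap.sub_apply, Module.End.one_apply]
          module
      refine sup_le (fun x hx => (key x hx).1) ?_
      rintro _ ⟨x, hx, rfl⟩
      exact (key x hx).2
  have hZ : f.maxGenEigenspace 0 = eigenSum f {0} := by simp [eigenSum]
  have hd0 : Disjoint {0} (upperHalf ∪ -upperHalf) := by simp [upperHalf]
  have hZo : f.maxGenEigenspace 0 ≤ B.orthogonal (P ⊔ Q) := by
    rw [hZ, hPQ]; exact eigenSum_le_orthogonal hA hf hd0
  have htop : P ⊔ Q ⊔ f.maxGenEigenspace 0 = ⊤ := by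
    rw [hZ, hPQ, eq_top_iff, ← f.iSup_maxGenEigenspace_eq_top]
    refine iSup_le fun a => ?_
    have hmem : a ∈ upperHalf ∪ -upperHalf ∨ a ∈ ({0} : Set ℂ) := by
      simp only [upperHalf, Set.mem_union, Set.mem_neg, Set.mem_ofPred_eq, Complex.neg_re,
        Complex.neg_im, Set.mem_singleton_iff, Complex.ext_iff, Complex.zero_re, Complex.zero_im]
      grind
    rcases hmem with h | h
    · exact le_sup_of_le_left (le_iSup₂_of_le a h le_rfl)
    · exact le_sup_of_le_right (le_iSup₂_of_le a h le_rfl)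
  refine h0.exists_sup_eq_top hB hA hf (n := Module.finrank ℂ V)
    (eq_top_iff.2 (htop ▸ sup_le_sup_left hZo _)) fun x hx => ?_
  obtain ⟨a, ha, z, hz, rfl⟩ := Submodule.mem_sup.1
    (htop ▸ Submodule.mem_top : x ∈ P ⊔ Q ⊔ f.maxGenEigenspace 0)
  have ha' : a ∈ B.orthogonal (P ⊔ Q) := by
    simpa using Submodule.sub_mem _ hx (hZo hz)
  -- Thus the orthogonal complement is exactly the generalized kernel, where `f` is nilpotent.
  have ha0 : a = 0 := by
    refine hB.1 _ fun y => ?_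
    obtain ⟨b, hb, c, hc, rfl⟩ := Submodule.mem_sup.1
      (htop ▸ Submodule.mem_top : y ∈ P ⊔ Q ⊔ f.maxGenEigenspace 0)
    rw [map_add, hA.eq_neg, show B b a = 0 from ha' b hb, show B a c = 0 from hZo hc a ha]
    simp
  rw [f.maxGenEigenspace_eq_genEigenspace_finrank, Module.End.mem_genEigenspace_nat] at hz
  simpa [ha0] using hz

/-! ### From swap pairs to symplectic involutions -/

theorem IsSwapPair.exists_involution (hB : B.Nondegenerate) (hA : B.IsAlt) {P Q : Submodule ℂ V}
    (h : IsSwapPair B f P Q) (hPQ : P ⊔ Q = ⊤) :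
    ∃ g : Module.End ℂ V, g * g = 1 ∧ (∀ x y, B (g x) (g y) = B x y) ∧
      ∀ x, g (f x) = -f (g x) := by
  have hc : IsCompl P Q := by
    -- A common vector is orthogonal to both `P` and `Q`, hence to everything.
    refine ⟨Submodule.disjoint_def.2 fun x hx hx' => hB.1 _ fun y => ?_,
      codisjoint_iff.2 hPQ⟩
    obtain ⟨a, ha, b, hb, rfl⟩ := Submodule.mem_sup.1 (hPQ ▸ Submodule.mem_top : y ∈ P ⊔ Q)
    rw [map_add, h.orth x hx b hb, hA.eq_neg, h.orth a ha x hx']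
    simp
  set π := P.projection Q hc with hπ
  have hP : ∀ a ∈ P, π a = a := fun a ha => Submodule.projection_apply_of_mem_left hc ha
  have hQ : ∀ a ∈ Q, π a = 0 := fun a ha => by
    rw [hπ, Submodule.projection_apply, (Submodule.projectionOnto_apply_eq_zero_iff hc).2 ha]; rfl
  let g : Module.End ℂ V := (2 : ℂ) • π - 1
  have hgP : ∀ a ∈ P, g a = a := fun a ha => by simp [g, hP a ha, two_smul]
  have hgQ : ∀ a ∈ Q, g a = -a := fun a ha => by simp [g, hQ a ha]
  have hdec : ∀ x, ∃ a ∈ P, ∃ b ∈ Q, a + b = x := fun x =>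
    Submodule.mem_sup.1 (hPQ ▸ Submodule.mem_top : x ∈ P ⊔ Q)
  refine ⟨g, ?_, fun x y => ?_, fun x => ?_⟩
  · ext x
    obtain ⟨a, ha, b, hb, rfl⟩ := hdec x
    simp [hgP a ha, hgQ b hb]
  · obtain ⟨a, ha, b, hb, rfl⟩ := hdec x
    obtain ⟨c, hc, d, hd, rfl⟩ := hdec y
    have h1 := h.orth a ha d hd
    have h2 : B b c = 0 := by rw [hA.eq_neg, h.orth c hc b hb, neg_zero]
    simp [hgP a ha, hgQ b hb, hgP c hc, hgQ d hd, h1, h2]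
  · obtain ⟨a, ha, b, hb, rfl⟩ := hdec x
    simp [hgP a ha, hgQ b hb, hgQ _ (h.map_left a ha), hgP _ (h.map_right b hb), add_comm]

end LinearMap.BilinForm

open Matrix in
theorem Matrix.exists_symplectic_involution {n : ℕ}
    {X : Matrix (Fin n ⊕ Fin n) (Fin n ⊕ Fin n) ℂ} (hX : X ∈ skewHamiltonian n)
    {G : Matrix (Fin n ⊕ Fin n) (Fin n ⊕ Fin n) ℂ} (hG : IsUnit G) (hGX : G * X = -X * G) :
    ∃ H ∈ symplecticGroup (Fin n) ℂ, H * H = 1 ∧ H * X = -X * H := by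
  set B : LinearMap.BilinForm ℂ (Fin n ⊕ Fin n → ℂ) := (J (Fin n) ℂ).toBilin' with hBdef
  have hB : B.Nondegenerate := LinearMap.BilinForm.nondegenerate_toBilin'_of_det_ne_zero' _
    (isUnit_det_J (Fin n) ℂ).ne_zero
  have hA : B.IsAlt := fun x => by
    have h : B x x = -B x x := by
      rw [hBdef, Matrix.toBilin'_apply']
      conv_lhs => rw [dotProduct_comm, dotProduct_comm, dotProduct_mulVec, ← mulVec_transpose,
        J_transpose, neg_mulVec, neg_dotProduct, dotProduct_comm]
    exact self_eq_neg.1 h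
  have hf : ∀ x y, B (toLin' X x) y = B x (toLin' X y) := fun x y => by
    have hX' : Xᵀ * J (Fin n) ℂ = J (Fin n) ℂ * X := hX
    rw [hBdef, Matrix.toBilin'_apply', Matrix.toBilin'_apply', toLin'_apply, toLin'_apply,
      mulVec_mulVec, ← hX', ← mulVec_mulVec, dotProduct_mulVec x, vecMul_transpose]
  have hanti : ∀ x, toLin' G (toLin' X x) = -toLin' X (toLin' G x) := fun x => by
    rw [toLin'_apply, toLin'_apply, toLin'_apply, toLin'_apply, mulVec_mulVec, hGX,
      ← mulVec_mulVec, neg_mulVec]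
  have hGu : IsUnit (toLin' G) := hG.map (toLinAlgEquiv' (R := ℂ))
  obtain ⟨k, hiso, hk⟩ := LinearMap.BilinForm.exists_isometry_anticommute hB hA hf hGu hanti
  obtain ⟨P, Q, hPQ, htop⟩ := LinearMap.BilinForm.exists_isSwapPair_sup_eq_top hB hA hf hiso hk
  obtain ⟨g, hgg, hg, hgf⟩ := hPQ.exists_involution hB hA htop
  obtain ⟨H, rfl⟩ := (toLin' (R := ℂ)).surjective g
  refine ⟨H, ?_, ?_, ?_⟩
  · rw [SymplecticGroup.mem_iff']
    apply (toBilin' (R₁ := ℂ)).injective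
    rw [← toBilin'_comp]
    exact LinearMap.ext₂ hg
  · apply (toLin' (R := ℂ)).injective
    rw [toLin'_mul, toLin'_one]
    exact hgg
  · apply (toLin' (R := ℂ)).injective
    rw [toLin'_mul, toLin'_mul, map_neg]
    exact LinearMap.ext hgf

theorem theorem1p4 (n : ℕ) (X : Matrix (Fin n ⊕ Fin n) (Fin n ⊕ Fin n) ℂ)
    (hX : X ∈ skewHamiltonian n) :
    MatrixSimilar X (-X) ↔ SimilarViaSymplecticInvolution X (-X) := by
  constructor
  · rintro ⟨G, hG⟩
    obtain ⟨H, hH, hHH, hHX⟩ := Matrix.exists_symplectic_involution hX G.isUnit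
      (by rw [← hG, Units.inv_mul_cancel_right])
    have h2 : (⟨H, hH⟩ : Matrix.symplecticGroup (Fin n) ℂ) ^ 2 = 1 :=
      Subtype.ext (by simpa [pow_two] using hHH)
    refine ⟨⟨H, hH⟩, h2, ?_⟩
    -- An involution is its own inverse.
    rw [inv_eq_of_mul_eq_one_right ((pow_two _).symm.trans h2)]
    change H * X * H = -X
    rw [hHX, mul_assoc, hHH, mul_one]
  · rintro ⟨g, -, hg⟩
    refine ⟨Units.map (Matrix.symplecticGroup (Fin n) ℂ).subtype (toUnits g), ?_⟩
    rw [← map_inv, ← map_inv]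
    exact hg
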